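/- Let $Q$ be a smooth manifold with a nonholonomic system: a lagrangian $L(v)=\tfrac12\kappa(v,v)-U$ on $TQ$, where $\kappa$ is a Riemannian metric and $U\in C^\infty(Q)$, and a smooth constant rank distribution $D\subset TQ$. Let $\mathcal M=\kappa^\flat(D)\subset T^*Q$ be the constraint submanifold, $\tau:\mathcal M\to Q$ the projection, $\iota:\mathcal M\to T^*Q$ the inclusion, $\Omega_{\mathcal M}=\iota^*\Omega_Q$ the pullback of the canonical 2-form of $T^*Q$, and $\mathcal C_m=\{v\in T_m\mathcal M : T\tau(v)\in D_{\tau(m)}\}$. Let a Lie group $G$ act smoothly, freely and properly on $Q$ so that the tangent lift of the action leaves $L$ and $D$ invariant, and suppose that the dimension assumption $T_qQ=D_q+T_q(G\cdot q)$ holds for all $q\in Q$. Then $G$ acts on $\mathcal M$ by the cotangent lift; let $\rho:\mathcal M\to\mathcal M/G$ be the projection to the quotient manifold, $\mathcal V_m=T_m(G\cdot m)$ and $\mathcal S_m=\mathcal C_m\cap\mathcal V_m$. Let $B$ be a $G$-invariant 2-form on $\mathcal M$ such that $(\Omega_{\mathcal M}+B)|_{\mathcal C}$ is nondegenerate, and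 let $\pi_B$ be the bivector field on $\mathcal M$ given by $\pi_B^\sharp(\alpha)=-X$ if and only if $X\in\Gamma(\mathcal C)$ and $\mathbf i_X(\Omega_{\mathcal M}+B)|_{\mathcal C}=\alpha|_{\mathcal C}$. Let $\pi^B_{\rm red}$ be the reduced bivector field on $\mathcal M/G$, determined by $\pi^B_{\rm red}(df,dg)\circ\rho=\pi_B(d(f\circ\rho),d(g\circ\rho))$ for $f,g\in C^\infty(\mathcal M/G)$. If there are $G$-invariant functions $J_1,\dots,J_k\in C^\infty(\mathcal M)$ such that the vector fields $\pi_B^\sharp(dJ_1),\dots,\pi_B^\sharp(dJ_k)$ span $\mathcal S$ at every point of $\mathcal M$, then the characteristic distribution of $\pi^B_{\rm red}$, that is, the image of $(\pi^B_{\rm red})^\sharp:T^*(\mathcal M/G)\to T(\mathcal M/G)$, is involutive: the Lie bracket of any two smooth local sections of it is again a section of it. -/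

import Mathlib

open Bundle Manifold
open scoped ContDiff

set_option linter.unusedSectionVars false

noncomputable section

namespace Nonholonomic

/-! ### Tensors, distributions and the exterior derivative on manifolds without boundary -/

section General

variable (E : Type*) [NormedAddCommGroup E] [NormedSpace ℝ E]
  (N : Type*) [TopologicalSpace N] [ChartedSpace E N]

/-- A smooth 2-form on the manifold `N`: a smooth family of alternating bilinear forms on the
tangent spaces. -/
structure TwoForm [IsManifold 𝓘(ℝ, E) ∞ N] where
  /-- The bilinear form on the tangent space at a point. -/
  toFun : ∀ x : N, TangentSpace 𝓘(ℝ, E) x →L[ℝ] TangentSpace 𝓘(ℝ, E) x →L[ℝ] ℝ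
  alternating : ∀ (x : N) (v : TangentSpace 𝓘(ℝ, E) x), toFun x v v = 0
  smooth : ContMDiff 𝓘(ℝ, E) (𝓘(ℝ, E).prod 𝓘(ℝ, E →L[ℝ] E →L[ℝ] ℝ)) ∞
    (fun x ↦ TotalSpace.mk' (E →L[ℝ] E →L[ℝ] ℝ)
      (E := fun x : N ↦ TangentSpace 𝓘(ℝ, E) x →L[ℝ] TangentSpace 𝓘(ℝ, E) x →L[ℝ] ℝ) x (toFun x))

variable {E N}

/-- The vector field `X` is smooth on the set `U`. -/
def SmoothVectorFieldOn [IsManifold 𝓘(ℝ, E) ∞ N] (X : ∀ x : N, TangentSpace 𝓘(ℝ, E) x)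
    (U : Set N) : Prop :=
  ContMDiffOn 𝓘(ℝ, E) 𝓘(ℝ, E).tangent ∞ (fun x ↦ (⟨x, X x⟩ : TangentBundle 𝓘(ℝ, E) N)) U

/-- `D` is a smooth distribution of constant rank (a subbundle of the tangent bundle): for some
`r`, near every point it is framed by `r` smooth vector fields. -/
def IsSmoothDistribution [IsManifold 𝓘(ℝ, E) ∞ N]
    (D : ∀ x : N, Submodule ℝ (TangentSpace 𝓘(ℝ, E) x)) : Prop :=
  ∃ r : ℕ, ∀ x₀ : N, ∃ U : Set N, IsOpen U ∧ x₀ ∈ U ∧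
    ∃ X : Fin r → ∀ x : N, TangentSpace 𝓘(ℝ, E) x,
      (∀ i, SmoothVectorFieldOn (X i) U) ∧
      ∀ x ∈ U, LinearIndependent ℝ (fun i ↦ X i x) ∧
        Submodule.span ℝ (Set.range fun i ↦ X i x) = D x

/-- A (generalized) distribution `D` is involutive: the Lie bracket of any two smooth local
sections of `D` is again a section of `D`. -/
def IsInvolutive [IsManifold 𝓘(ℝ, E) ∞ N]
    (D : ∀ x : N, Submodule ℝ (TangentSpace 𝓘(ℝ, E) x)) : Prop :=
  ∀ (U : Set N), IsOpen U → ∀ X Y : ∀ x : N, TangentSpace 𝓘(ℝ, E) x,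
    SmoothVectorFieldOn X U → SmoothVectorFieldOn Y U →
    (∀ x ∈ U, X x ∈ D x) → (∀ x ∈ U, Y x ∈ D x) →
    ∀ x ∈ U, VectorField.mlieBracket 𝓘(ℝ, E) X Y x ∈ D x

variable {F H P : Type*} [NormedAddCommGroup F] [NormedSpace ℝ F] [TopologicalSpace H]
  [TopologicalSpace P] [ChartedSpace H P]

/-- The exterior derivative of a 1-form on a manifold without boundary, computed in the preferred
chart `φ` at `x`: if `a = (φ⁻¹)^* α`, then
`dα_x(u, v) = (D a(Tφ u))(Tφ v) - (D a(Tφ v))(Tφ u)`. -/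
def extDerivOneForm (I : ModelWithCorners ℝ F H) [I.Boundaryless]
    (α : ∀ x : P, TangentSpace I x →L[ℝ] ℝ) (x : P) :
    TangentSpace I x →L[ℝ] TangentSpace I x →L[ℝ] ℝ :=
  let a : F → F →L[ℝ] ℝ := fun y ↦
    (α ((extChartAt I x).symm y)).comp (mfderiv 𝓘(ℝ, F) I (extChartAt I x).symm y)
  let φ' : F →L[ℝ] F := mfderiv I 𝓘(ℝ, F) (extChartAt I x) x
  let A : F →L[ℝ] F →L[ℝ] ℝ := (fderiv ℝ a (extChartAt I x x)).bilinearComp φ' φ'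
  (A - A.flip : F →L[ℝ] F →L[ℝ] ℝ)

end General

/-! ### The cotangent bundle and its canonical 2-form -/

section Cotangent

variable (E : Type*) [NormedAddCommGroup E] [NormedSpace ℝ E]
  (Q : Type*) [TopologicalSpace Q] [ChartedSpace E Q] [IsManifold 𝓘(ℝ, E) ∞ Q]

/-- The cotangent bundle `T^*Q`. -/
abbrev CotangentBundle : Type _ :=
  TotalSpace (E →L[ℝ] ℝ) (fun q : Q ↦ TangentSpace 𝓘(ℝ, E) q →L[ℝ] Bundle.Trivial Q ℝ q)

/-- The model with corners of `T^*Q`. -/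
abbrev cotangentModel : ModelWithCorners ℝ (E × (E →L[ℝ] ℝ)) (ModelProd E (E →L[ℝ] ℝ)) :=
  𝓘(ℝ, E).prod 𝓘(ℝ, E →L[ℝ] ℝ)

variable {E Q}

/-- The canonical (Liouville) 1-form on `T^*Q`: `Θ_p(w) = p(Tπ w)`. -/
def liouvilleForm (p : CotangentBundle E Q) : TangentSpace (cotangentModel E) p →L[ℝ] ℝ :=
  p.2.comp (mfderiv (cotangentModel E) 𝓘(ℝ, E) (TotalSpace.proj : CotangentBundle E Q → Q) p)

/-- The canonical 2-form `Ω_Q = -dΘ` on `T^*Q`. -/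
def canonicalForm (p : CotangentBundle E Q) :
    TangentSpace (cotangentModel E) p →L[ℝ] TangentSpace (cotangentModel E) p →L[ℝ] ℝ :=
  -extDerivOneForm (cotangentModel E) (liouvilleForm (E := E) (Q := Q)) p

variable {G : Type*} [Group G] [MulAction G Q]

/-- The tangent map at `q` of the transformation of `Q` defined by `g`. -/
def tangentAction (g : G) (q : Q) :
    TangentSpace 𝓘(ℝ, E) q →L[ℝ] TangentSpace 𝓘(ℝ, E) (g • q) :=
  mfderiv 𝓘(ℝ, E) 𝓘(ℝ, E) (fun x : Q ↦ g • x) q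

/-- The cotangent lift of the transformation of `Q` defined by `g`: a covector `p` at `q` is sent
to the covector `p ∘ T_{g q}(g⁻¹)` at `g q`. -/
def cotangentLift (g : G) (p : CotangentBundle E Q) : CotangentBundle E Q :=
  ⟨g • p.1, p.2.comp
    (mfderiv 𝓘(ℝ, E) 𝓘(ℝ, E) (fun x : Q ↦ g⁻¹ • x) (g • p.1) :
      TangentSpace 𝓘(ℝ, E) (g • p.1) →L[ℝ] E)⟩

end Cotangent

/-! ### Nonholonomic systems and their symmetries -/

section System

variable (E : Type*) [NormedAddCommGroup E] [NormedSpace ℝ E]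
  (Q : Type*) [TopologicalSpace Q] [ChartedSpace E Q] [IsManifold 𝓘(ℝ, E) ∞ Q]

/-- A nonholonomic system on `Q`: a lagrangian of mechanical type, given by a kinetic energy
metric and a potential, and a smooth constraint distribution of constant rank. -/
structure System where
  /-- The kinetic energy metric. -/
  metric : ContMDiffRiemannianMetric 𝓘(ℝ, E) ∞ E (fun q : Q ↦ TangentSpace 𝓘(ℝ, E) q)
  /-- The potential energy. -/
  potential : Q → ℝ
  potential_smooth : ContMDiff 𝓘(ℝ, E) 𝓘(ℝ, ℝ) ∞ potential
  /-- The constraint distribution. -/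
  D : ∀ q : Q, Submodule ℝ (TangentSpace 𝓘(ℝ, E) q)
  D_smooth : IsSmoothDistribution D

variable {E Q}

namespace System

variable (sys : System E Q)

/-- The lagrangian `L(v) = ½ κ(v, v) - U(q)`. -/
def lagrangian (v : TangentBundle 𝓘(ℝ, E) Q) : ℝ :=
  (1 / 2) * sys.metric.inner v.1 v.2 v.2 - sys.potential v.1

/-- The constraint submanifold `κ^♭(D)` as a subset of `T^*Q`. -/
def constraintSet : Set (CotangentBundle E Q) :=
  {p | ∃ v ∈ sys.D p.1, p.2 = sys.metric.inner p.1 v}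

/-- The constraint submanifold `M = κ^♭(D)`, with the subspace topology. -/
abbrev M : Type _ := sys.constraintSet

/-- The projection `τ : M → Q`. -/
def τ (m : sys.M) : Q := m.1.1

variable (EG : Type*) [NormedAddCommGroup EG] [NormedSpace ℝ EG]
  (G : Type*) [Group G] [TopologicalSpace G] [ChartedSpace EG G] [MulAction G Q]

/-- The action of the Lie group `G` on `Q` is a symmetry of the nonholonomic system: it is smooth,
and its tangent lift leaves the lagrangian and the constraint distribution invariant. -/
structure IsSymmetry : Prop where
  smooth_action : ContMDiff (𝓘(ℝ, EG).prod 𝓘(ℝ, E)) 𝓘(ℝ, E) ∞ (fun x : G × Q ↦ x.1 • x.2)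
  lagrangian_invariant : ∀ (g : G) (q : Q) (v : TangentSpace 𝓘(ℝ, E) q),
    sys.lagrangian ⟨g • q, tangentAction g q v⟩ = sys.lagrangian ⟨q, v⟩
  distribution_invariant : ∀ (g : G) (q : Q), ∀ v ∈ sys.D q, tangentAction g q v ∈ sys.D (g • q)

variable {EG G} {sys}

namespace IsSymmetry

lemma mdifferentiable (h : sys.IsSymmetry EG G) (g : G) :
    MDifferentiable 𝓘(ℝ, E) 𝓘(ℝ, E) (fun x : Q ↦ g • x) := by
  have h1 : ContMDiff 𝓘(ℝ, E) (𝓘(ℝ, EG).prod 𝓘(ℝ, E)) ∞ (fun x : Q ↦ (g, x)) :=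
    contMDiff_const.prodMk contMDiff_id
  exact (h.smooth_action.comp h1).mdifferentiable (by simp)

lemma mfderiv_mul (h : sys.IsSymmetry EG G) (g g' : G) (q : Q) :
    (mfderiv 𝓘(ℝ, E) 𝓘(ℝ, E) (fun x : Q ↦ (g * g') • x) q : E →L[ℝ] E) =
      (mfderiv 𝓘(ℝ, E) 𝓘(ℝ, E) (fun x : Q ↦ g • x) (g' • q) : E →L[ℝ] E).comp
        (mfderiv 𝓘(ℝ, E) 𝓘(ℝ, E) (fun x : Q ↦ g' • x) q : E →L[ℝ] E) := by
  have h1 : (fun x : Q ↦ (g * g') • x) = (fun x : Q ↦ g • x) ∘ (fun x : Q ↦ g' • x) := by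
    funext x; exact mul_smul g g' x
  rw [h1]
  exact mfderiv_comp q (h.mdifferentiable g _) (h.mdifferentiable g' _)

lemma mfderiv_one (q : Q) :
    (mfderiv 𝓘(ℝ, E) 𝓘(ℝ, E) (fun x : Q ↦ (1 : G) • x) q : E →L[ℝ] E) =
      ContinuousLinearMap.id ℝ E := by
  have h1 : (fun x : Q ↦ (1 : G) • x) = id := by funext x; exact one_smul G x
  rw [h1]
  exact mfderiv_id

lemma mk_eq_mk {x y : Q} (hxy : x = y) {a b : E →L[ℝ] ℝ} (hab : a = b) :
    (⟨x, a⟩ : CotangentBundle E Q) = ⟨y, b⟩ := by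
  subst hxy; subst hab; rfl

lemma cotangentLift_one (p : CotangentBundle E Q) : cotangentLift (1 : G) p = p := by
  refine mk_eq_mk (E := E) (one_smul G p.1) ?_
  ext w
  have h1 : (mfderiv 𝓘(ℝ, E) 𝓘(ℝ, E) (fun x : Q ↦ (1 : G)⁻¹ • x) ((1 : G) • p.1) : E →L[ℝ] E) =
      ContinuousLinearMap.id ℝ E := by
    rw [inv_one]
    exact mfderiv_one _
  exact congrArg (fun f : E →L[ℝ] E ↦ (p.2 : E →L[ℝ] ℝ) (f w)) h1

lemma cotangentLift_mul (h : sys.IsSymmetry EG G) (g g' : G) (p : CotangentBundle E Q) :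
    cotangentLift (g * g') p = cotangentLift g (cotangentLift g' p) := by
  refine mk_eq_mk (E := E) (mul_smul g g' p.1) ?_
  ext w
  have h1 := h.mfderiv_mul g'⁻¹ g⁻¹ (g • g' • p.1)
  rw [inv_smul_smul, ← mul_inv_rev] at h1
  rw [mul_smul]
  exact congrArg (fun f : E →L[ℝ] E ↦ (p.2 : E →L[ℝ] ℝ) (f w)) h1

lemma metric_invariant (h : sys.IsSymmetry EG G) (g : G) (q : Q)
    (v w : TangentSpace 𝓘(ℝ, E) q) :
    sys.metric.inner (g • q) (tangentAction g q v) (tangentAction g q w) =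
      sys.metric.inner q v w := by
  have h0 := h.lagrangian_invariant g q 0
  have hv := h.lagrangian_invariant g q v
  have hw := h.lagrangian_invariant g q w
  have hvw := h.lagrangian_invariant g q (v + w)
  have s1 := sys.metric.symm q v w
  have s2 := sys.metric.symm (g • q) (tangentAction g q v) (tangentAction g q w)
  simp only [lagrangian, map_zero, map_add, add_apply] at h0 hv hw hvw
  linarith

lemma cotangentLift_mem (h : sys.IsSymmetry EG G) (g : G) {p : CotangentBundle E Q}
    (hp : p ∈ sys.constraintSet) : cotangentLift g p ∈ sys.constraintSet := by
  obtain ⟨v, hv, hpv⟩ := hp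
  refine ⟨tangentAction g p.1 v, h.distribution_invariant g p.1 v hv, ?_⟩
  ext w
  let u : TangentSpace 𝓘(ℝ, E) p.1 :=
    (mfderiv 𝓘(ℝ, E) 𝓘(ℝ, E) (fun x : Q ↦ g⁻¹ • x) (g • p.1) : E →L[ℝ] E) w
  have h1 := h.mfderiv_mul g g⁻¹ (g • p.1)
  rw [mul_inv_cancel, mfderiv_one, inv_smul_smul] at h1
  have h2 : tangentAction g p.1 u = w :=
    (congrArg (fun f : E →L[ℝ] E ↦ f w) h1).symm
  have h3 := h.metric_invariant g p.1 v u
  rw [h2] at h3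
  have h4 : (cotangentLift g p).2 w = p.2 u := rfl
  rw [h4, hpv]
  exact h3.symm

/-- The action of `G` on `M`: the restriction of the cotangent lift of the action on `Q`. -/
def act (h : sys.IsSymmetry EG G) (g : G) (m : sys.M) : sys.M :=
  ⟨cotangentLift g m.1, h.cotangentLift_mem g m.2⟩

/-- The action of `G` on `M` as a `MulAction`. -/
@[reducible] def mulAction (h : sys.IsSymmetry EG G) : MulAction G sys.M where
  smul := h.act
  one_smul m := Subtype.ext (cotangentLift_one m.1)
  mul_smul g g' m := Subtype.ext (h.cotangentLift_mul g g' m.1)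

/-- The equivalence relation on `M` whose classes are the `G`-orbits. -/
@[reducible] def orbitSetoid (h : sys.IsSymmetry EG G) : Setoid sys.M :=
  @MulAction.orbitRel G sys.M _ h.mulAction

/-- The orbit space `M/G`, with the quotient topology. -/
abbrev OrbitSpace (h : sys.IsSymmetry EG G) : Type _ := Quotient h.orbitSetoid

/-- The orbit projection `ρ : M → M/G`. -/
def ρ (h : sys.IsSymmetry EG G) (m : sys.M) : h.OrbitSpace := Quotient.mk h.orbitSetoid m

end IsSymmetry

/-- The tangent spaces of the orbits of `G` on `Q`: `V_q = T_q(G q)` is the space of the values at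
`q` of the infinitesimal generators, that is, the image of `T_1 G` under the tangent map at `1` of
the orbit map `g ↦ g • q` (recall that `1 • q = q`). -/
def verticalQ (sys : System E Q) (_h : sys.IsSymmetry EG G) (q : Q) :
    Submodule ℝ (TangentSpace 𝓘(ℝ, E) q) :=
  LinearMap.range (mfderiv 𝓘(ℝ, EG) 𝓘(ℝ, E) (fun g : G ↦ g • q) 1 : EG →L[ℝ] E).toLinearMap

/-- The dimension assumption `T_q Q = D_q + V_q` for all `q`. -/
def DimensionAssumption (sys : System E Q) (h : sys.IsSymmetry EG G) : Prop :=
  ∀ q : Q, sys.D q ⊔ sys.verticalQ h q = ⊤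

/-! ### Geometry of the constraint submanifold

`M ⊆ T^*Q` carries the smooth structure of an embedded submanifold. -/

variable {EM : Type*} [NormedAddCommGroup EM] [NormedSpace ℝ EM]
  [ChartedSpace EM sys.M] [IsManifold 𝓘(ℝ, EM) ∞ sys.M]

variable (EM sys) in
/-- The smooth structure of `M` is that of an embedded submanifold of `T^*Q`. -/
def IsEmbeddedSubmanifold : Prop :=
  IsSmoothEmbedding 𝓘(ℝ, EM) (cotangentModel E) ∞ (Subtype.val : sys.M → CotangentBundle E Q)

variable (EM sys) in
/-- The distribution `C_m = {v ∈ T_m M | Tτ(v) ∈ D_{τ(m)}}`. -/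
def C (m : sys.M) : Submodule ℝ (TangentSpace 𝓘(ℝ, EM) m) :=
  (sys.D (sys.τ m)).comap (mfderiv 𝓘(ℝ, EM) 𝓘(ℝ, E) sys.τ m).toLinearMap

variable (EM sys) in
/-- The 2-form `Ω_M = ι^* Ω_Q`, where `ι : M → T^*Q` is the inclusion. -/
def ΩM (m : sys.M) : TangentSpace 𝓘(ℝ, EM) m →L[ℝ] TangentSpace 𝓘(ℝ, EM) m →L[ℝ] ℝ :=
  let ι' : EM →L[ℝ] E × (E →L[ℝ] ℝ) :=
    mfderiv 𝓘(ℝ, EM) (cotangentModel E) (Subtype.val : sys.M → CotangentBundle E Q) m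
  let Ω : (E × (E →L[ℝ] ℝ)) →L[ℝ] (E × (E →L[ℝ] ℝ)) →L[ℝ] ℝ := canonicalForm m.1
  (Ω.bilinearComp ι' ι' : EM →L[ℝ] EM →L[ℝ] ℝ)

/-- The 2-form `Ω_M + B`. -/
def ΩB (B : TwoForm EM sys.M) (m : sys.M) :
    TangentSpace 𝓘(ℝ, EM) m →L[ℝ] TangentSpace 𝓘(ℝ, EM) m →L[ℝ] ℝ :=
  sys.ΩM EM m + B.toFun m

/-- `(Ω_M + B)|_C` is nondegenerate. -/
def Nondegenerate (B : TwoForm EM sys.M) : Prop :=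
  ∀ m : sys.M, ∀ X ∈ sys.C EM m, (∀ Y ∈ sys.C EM m, ΩB B m X Y = 0) → X = 0

/-- The map `C_m → C_m^*`, `X ↦ i_X (Ω_M + B)|_C`. -/
def flatC (B : TwoForm EM sys.M) (m : sys.M) : sys.C EM m →ₗ[ℝ] Module.Dual ℝ (sys.C EM m) where
  toFun X := (ΩB B m X).toLinearMap.comp (sys.C EM m).subtype
  map_add' X Y := by ext; simp
  map_smul' c X := by ext; simp

lemma flatC_injective {B : TwoForm EM sys.M} (hB : Nondegenerate B) (m : sys.M) :
    Function.Injective (flatC B m) := by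
  rw [← LinearMap.ker_eq_bot, LinearMap.ker_eq_bot']
  intro X hX
  refine Subtype.ext (hB m X X.2 fun Y hY ↦ ?_)
  exact congrArg (fun f ↦ f ⟨Y, hY⟩) hX

variable [FiniteDimensional ℝ EM]

instance (m : sys.M) : FiniteDimensional ℝ (TangentSpace 𝓘(ℝ, EM) m) :=
  inferInstanceAs (FiniteDimensional ℝ EM)

/-- The gauge related bivector field `π_B`, as the map `π_B^♯ : T^*_m M → T_m M`:
`π_B^♯(α) = -X`, where `X ∈ C_m` is determined by `i_X (Ω_M + B)|_C = α|_C`. -/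
def sharp (B : TwoForm EM sys.M) (hB : Nondegenerate B) (m : sys.M) :
    (TangentSpace 𝓘(ℝ, EM) m →L[ℝ] ℝ) →ₗ[ℝ] TangentSpace 𝓘(ℝ, EM) m :=
  -((sys.C EM m).subtype ∘ₗ
    ((flatC B m).linearEquivOfInjective (flatC_injective hB m)
      (Subspace.dual_finrank_eq).symm).symm.toLinearMap ∘ₗ
    (sys.C EM m).subtype.dualMap ∘ₗ ContinuousLinearMap.coeLM ℝ)

/-- The defining relation of `π_B^♯`. -/
lemma sharp_eq_neg_iff (B : TwoForm EM sys.M) (hB : Nondegenerate B) (m : sys.M)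
    (α : TangentSpace 𝓘(ℝ, EM) m →L[ℝ] ℝ) (X : TangentSpace 𝓘(ℝ, EM) m) :
    sharp B hB m α = -X ↔ X ∈ sys.C EM m ∧ ∀ Y ∈ sys.C EM m, ΩB B m X Y = α Y := by
  set X₀ : sys.C EM m := ((flatC B m).linearEquivOfInjective (flatC_injective hB m)
      (Subspace.dual_finrank_eq).symm).symm ((sys.C EM m).subtype.dualMap α.toLinearMap) with hX₀
  have h1 : flatC B m X₀ = (sys.C EM m).subtype.dualMap α.toLinearMap := by
    have := ((flatC B m).linearEquivOfInjective (flatC_injective hB m)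
      (Subspace.dual_finrank_eq).symm).apply_symm_apply
        ((sys.C EM m).subtype.dualMap α.toLinearMap)
    exact this
  have h2 : sharp B hB m α = -(X₀ : TangentSpace 𝓘(ℝ, EM) m) := rfl
  have h3 : ∀ Y ∈ sys.C EM m, ΩB B m X₀ Y = α Y := fun Y hY ↦
    congrArg (fun f ↦ f ⟨Y, hY⟩) h1
  rw [h2, neg_inj]
  constructor
  · rintro rfl
    exact ⟨X₀.2, h3⟩
  · rintro ⟨hX, hY⟩
    have h4 : (X₀ : TangentSpace 𝓘(ℝ, EM) m) - X = 0 := by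
      refine hB m _ (sub_mem X₀.2 hX) fun Y hYC ↦ ?_
      rw [map_sub, sub_apply, h3 Y hYC, hY Y hYC, sub_self]
    exact sub_eq_zero.mp h4

/-! ### Symmetries and reduction -/

variable (EM) in
/-- The 2-form `B` on `M` is `G`-invariant. -/
def InvariantTwoForm (h : sys.IsSymmetry EG G) (B : TwoForm EM sys.M) : Prop :=
  ∀ (g : G) (m : sys.M) (u v : TangentSpace 𝓘(ℝ, EM) m),
    B.toFun (h.act g m) (mfderiv 𝓘(ℝ, EM) 𝓘(ℝ, EM) (h.act g) m u)
      (mfderiv 𝓘(ℝ, EM) 𝓘(ℝ, EM) (h.act g) m v) = B.toFun m u v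

variable (EM) in
/-- The tangent spaces of the orbits of `G` on `M`: `𝒱_m = T_m(G m)` is the image of `T_1 G` under
the tangent map at `1` of the orbit map `g ↦ g • m` (recall that `1 • m = m`). -/
def verticalM (h : sys.IsSymmetry EG G) (m : sys.M) : Submodule ℝ (TangentSpace 𝓘(ℝ, EM) m) :=
  LinearMap.range
    (mfderiv 𝓘(ℝ, EG) 𝓘(ℝ, EM) (fun g : G ↦ h.act g m) 1 : EG →L[ℝ] EM).toLinearMap

variable (EM) in
/-- The distribution `𝒮_m = C_m ∩ 𝒱_m` on `M`. -/
def S (h : sys.IsSymmetry EG G) (m : sys.M) : Submodule ℝ (TangentSpace 𝓘(ℝ, EM) m) :=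
  sys.C EM m ⊓ verticalM EM h m

/-- The vector field `π_B^♯(df)` on `M`. -/
def hamiltonianField (B : TwoForm EM sys.M) (hB : Nondegenerate B) (f : sys.M → ℝ) (m : sys.M) :
    TangentSpace 𝓘(ℝ, EM) m :=
  sharp B hB m (mfderiv 𝓘(ℝ, EM) 𝓘(ℝ, ℝ) f m : TangentSpace 𝓘(ℝ, EM) m →L[ℝ] ℝ)

variable {EB : Type*} [NormedAddCommGroup EB] [NormedSpace ℝ EB]

variable (EM EB) in
/-- The smooth structure of `M/G` is that of the quotient manifold: the orbit projection
`ρ : M → M/G` is a smooth submersion. -/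
def IsQuotientManifold (h : sys.IsSymmetry EG G) [ChartedSpace EB h.OrbitSpace] : Prop :=
  IsSubmersion 𝓘(ℝ, EM) 𝓘(ℝ, EB) ∞ h.ρ

/-- The reduced bivector field `π_red^B` on `M/G`, as the map
`(π_red^B)^♯(α) = Tρ(π_B^♯(ρ^* α)(m))` for `α ∈ T^*_x(M/G)`, where `ρ(m) = x`; equivalently,
`{f, g}_red ∘ ρ = {f ∘ ρ, g ∘ ρ}_B`. For `G`-invariant `B` it does not depend on the point `m` of
the orbit `x`. -/
def reducedSharp (h : sys.IsSymmetry EG G) [ChartedSpace EB h.OrbitSpace]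
    (B : TwoForm EM sys.M) (hB : Nondegenerate B) (x : h.OrbitSpace) :
    (TangentSpace 𝓘(ℝ, EB) x →L[ℝ] ℝ) →ₗ[ℝ] TangentSpace 𝓘(ℝ, EB) x :=
  let m : sys.M := Quotient.out x
  let ρ' : TangentSpace 𝓘(ℝ, EM) m →L[ℝ] EB := mfderiv 𝓘(ℝ, EM) 𝓘(ℝ, EB) h.ρ m
  { toFun := fun α : EB →L[ℝ] ℝ ↦ ρ' (sharp B hB m (α.comp ρ'))
    map_add' := fun α β ↦ by
      have h1 : ((α + β : EB →L[ℝ] ℝ)).comp ρ' =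
        ContinuousLinearMap.comp (α : EB →L[ℝ] ℝ) ρ' +
          ContinuousLinearMap.comp (β : EB →L[ℝ] ℝ) ρ' := rfl
      exact (congrArg (fun a ↦ ρ' (sharp B hB m a)) h1).trans (by rw [map_add, map_add]; rfl)
    map_smul' := fun c α ↦ by
      have h1 : ((c • α : EB →L[ℝ] ℝ)).comp ρ' =
        c • ContinuousLinearMap.comp (α : EB →L[ℝ] ℝ) ρ' := rfl
      exact (congrArg (fun a ↦ ρ' (sharp B hB m a)) h1).trans (by rw [map_smul, map_smul]; rfl) }

variable (EB) in
/-- The characteristic distribution of `π_red^B`: the image of `(π_red^B)^♯`, that is, the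
distribution spanned by the vectors `(π_red^B)^♯(df)`. -/
def reducedCharacteristicDistribution (h : sys.IsSymmetry EG G) [ChartedSpace EB h.OrbitSpace]
    (B : TwoForm EM sys.M) (hB : Nondegenerate B) (x : h.OrbitSpace) :
    Submodule ℝ (TangentSpace 𝓘(ℝ, EB) x) :=
  LinearMap.range (reducedSharp (EB := EB) h B hB x)

end System
end System
end Nonholonomic
end

open Nonholonomic

/-! Let `j i` be the function on `M/G` induced by the invariant function `J i`. The characteristic
distribution of the reduced bivector is exactly the common kernel of the differentials of the `j i`
(`mem_reducedCharacteristicDistribution_iff`). Vector fields annihilating fixed functions have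
brackets annihilating them too (`mfderiv_mlieBracket_eq_zero`), so involutivity follows, whatever
the rank does.

The identification is pointwise linear algebra (`exists_dual_comp_iff`). Write `β = Ω_M + B`. A
vector `Z` of `C` represents some `ρ^*α` on `C` iff `β(Z, ·)` vanishes on `C ∩ ker Tρ = 𝒮`. Since
`𝒮` is spanned by the fields `π_B^♯(dJ i)`, and these are dual to `-dJ i` on `C`, this says that
every `dJ i` kills `Z`. The dimension assumption lifts to `C + 𝒱 = TM` (`C_sup_verticalM`), so `Tρ`
maps `C` onto `T(M/G)`, and every common zero of the `d(j i)` is attained.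

The geometric input is `ker Tρ = 𝒱` (`ker_mfderiv_ρ`). Orbits lie in fibres, which gives one
inclusion; equality is a dimension count. Freeness makes orbit maps immersive at the identity
(`injective_mfderiv_orbitMap`), and a Hausdorff dimension estimate bounds the fibre dimension by
`dim G` (`finrank_le_add_of_fibre_subset_range`). -/

namespace Nonholonomic

/-! ### Lie brackets of vector fields annihilating a function -/

section LieBracket

variable {E : Type*} [NormedAddCommGroup E] [NormedSpace ℝ E] [CompleteSpace E]
  {N : Type*} [TopologicalSpace N] [ChartedSpace E N] [IsManifold 𝓘(ℝ, E) ∞ N]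

open VectorField in
/-- If the vector fields `X` and `Y` annihilate the function `f` near `x`, then so does their Lie
bracket at `x`. -/
lemma mfderiv_mlieBracket_eq_zero {f : N → ℝ} {X Y : ∀ x : N, TangentSpace 𝓘(ℝ, E) x} {x : N}
    (hf : ContMDiff 𝓘(ℝ, E) 𝓘(ℝ, ℝ) ∞ f)
    (hX : MDifferentiableAt 𝓘(ℝ, E) 𝓘(ℝ, E).tangent
      (fun x ↦ (⟨x, X x⟩ : TangentBundle 𝓘(ℝ, E) N)) x)
    (hY : MDifferentiableAt 𝓘(ℝ, E) 𝓘(ℝ, E).tangent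
      (fun x ↦ (⟨x, Y x⟩ : TangentBundle 𝓘(ℝ, E) N)) x)
    (hfX : ∀ᶠ y in nhds x, (mfderiv 𝓘(ℝ, E) 𝓘(ℝ, ℝ) f y : E →L[ℝ] ℝ) (X y) = 0)
    (hfY : ∀ᶠ y in nhds x, (mfderiv 𝓘(ℝ, E) 𝓘(ℝ, ℝ) f y : E →L[ℝ] ℝ) (Y y) = 0) :
    (mfderiv 𝓘(ℝ, E) 𝓘(ℝ, ℝ) f x : E →L[ℝ] ℝ) (mlieBracket 𝓘(ℝ, E) X Y x) = 0 := by
  have h2 : (2 : WithTop ℕ∞) ≤ ∞ := WithTop.coe_le_coe.2 (le_top (a := (2 : ℕ∞)))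
  have : IsManifold 𝓘(ℝ, E) 2 N := IsManifold.of_le h2
  have hf1 : MDifferentiable 𝓘(ℝ, E) 𝓘(ℝ, ℝ) f := hf.mdifferentiable (by simp)
  set φ := extChartAt 𝓘(ℝ, E) x with hφ
  have htgt : φ.target ∈ nhds (φ x) := extChartAt_target_mem_nhds x
  have hdiff : ∀ y ∈ φ.target, MDifferentiableAt 𝓘(ℝ, E) 𝓘(ℝ, E) φ.symm y := fun y hy ↦
    ((contMDiffOn_extChartAt_symm (n := ∞) x).contMDiffAt
      ((isOpen_extChartAt_target x).mem_nhds hy)).mdifferentiableAt (by simp)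
  -- the bracket and the function in the chart
  let V : E → E := mpullbackWithin 𝓘(ℝ, E) 𝓘(ℝ, E) φ.symm X (Set.range 𝓘(ℝ, E))
  let W : E → E := mpullbackWithin 𝓘(ℝ, E) 𝓘(ℝ, E) φ.symm Y (Set.range 𝓘(ℝ, E))
  let F : E → ℝ := f ∘ φ.symm
  have hFd : ∀ y ∈ φ.target, fderiv ℝ F y =
      (mfderiv 𝓘(ℝ, E) 𝓘(ℝ, ℝ) f (φ.symm y) : E →L[ℝ] ℝ).comp
        (mfderiv 𝓘(ℝ, E) 𝓘(ℝ, E) φ.symm y : E →L[ℝ] E) := fun y hy ↦ by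
    rw [← mfderiv_eq_fderiv]
    exact mfderiv_comp y (hf1 _) (hdiff y hy)
  -- Annihilation is needed on a neighbourhood: the derivative of this function at `φ x` enters the
  -- bracket formula.
  have key : ∀ Z : (∀ x : N, TangentSpace 𝓘(ℝ, E) x),
      (∀ᶠ y in nhds x, (mfderiv 𝓘(ℝ, E) 𝓘(ℝ, ℝ) f y : E →L[ℝ] ℝ) (Z y) = 0) →
      (fun y ↦ fderiv ℝ F y
        (mpullbackWithin 𝓘(ℝ, E) 𝓘(ℝ, E) φ.symm Z (Set.range 𝓘(ℝ, E)) y : E)) =ᶠ[nhds (φ x)]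
        fun _ ↦ (0 : ℝ) := fun Z hZ ↦ by
    have hc : Filter.Tendsto φ.symm (nhds (φ x)) (nhds x) := by
      have := (continuousAt_extChartAt_symm (I := 𝓘(ℝ, E)) x).tendsto
      rwa [extChartAt_to_inv] at this
    filter_upwards [htgt, hc.eventually hZ] with y hy hz
    have hinv := isInvertible_mfderivWithin_extChartAt_symm (I := 𝓘(ℝ, E)) hy
    rw [hFd y hy]
    have h1 : mfderivWithin 𝓘(ℝ, E) 𝓘(ℝ, E) φ.symm (Set.range 𝓘(ℝ, E)) y =
        mfderiv 𝓘(ℝ, E) 𝓘(ℝ, E) φ.symm y := by simp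
    have h2 : (mfderiv 𝓘(ℝ, E) 𝓘(ℝ, E) φ.symm y : E →L[ℝ] E)
        (mpullbackWithin 𝓘(ℝ, E) 𝓘(ℝ, E) φ.symm Z (Set.range 𝓘(ℝ, E)) y : E) =
        Z (φ.symm y) := by
      rw [mpullbackWithin_apply, ← h1]
      exact hinv.self_apply_inverse _
    exact (congrArg (mfderiv 𝓘(ℝ, E) 𝓘(ℝ, ℝ) f (φ.symm y) : E →L[ℝ] ℝ) h2).trans hz
  have hset : (extChartAt 𝓘(ℝ, E) x).symm ⁻¹' Set.univ ∩ Set.range 𝓘(ℝ, E) = Set.univ := by simp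
  have hV : DifferentiableAt ℝ V (φ x) := by
    have := (mdifferentiableWithinAt_univ.2 hX).differentiableWithinAt_mpullbackWithin_vectorField
    rw [hset] at this
    exact differentiableWithinAt_univ.1 this
  have hW : DifferentiableAt ℝ W (φ x) := by
    have := (mdifferentiableWithinAt_univ.2 hY).differentiableWithinAt_mpullbackWithin_vectorField
    rw [hset] at this
    exact differentiableWithinAt_univ.1 this
  have hFs : ContDiffAt ℝ ∞ F (φ x) := by
    rw [← contMDiffAt_iff_contDiffAt]
    refine ContMDiffAt.comp (I' := 𝓘(ℝ, E)) _ hf.contMDiffAt ?_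
    exact (contMDiffOn_extChartAt_symm (n := ∞) x).contMDiffAt htgt
  -- In the chart, `DF [V, W]` is a difference of derivatives of `DF W` and `DF V`, the second-order
  -- terms cancelling by symmetry of `D²F`. Both functions vanish near `φ x`.
  have hmain := fderiv_apply_lieBracket hFs (by simpa using h2) hW hV
  rw [(key X hfX).fderiv_eq, (key Y hfY).fderiv_eq] at hmain
  have h0 : fderiv ℝ F (φ x) (lieBracket ℝ V W (φ x)) = 0 := by rw [hmain]; simp
  have hbr : mlieBracket 𝓘(ℝ, E) X Y x =
      (mfderiv 𝓘(ℝ, E) 𝓘(ℝ, E) φ x : E →L[ℝ] E).inverse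
        (lieBracket ℝ V W (φ x) : E) := by
    rw [← mlieBracketWithin_univ, mlieBracketWithin_apply, hset]
    exact congrArg (mfderiv 𝓘(ℝ, E) 𝓘(ℝ, E) φ x : E →L[ℝ] E).inverse
      (congrFun (lieBracketWithin_univ (𝕜 := ℝ) (V := V) (W := W)) (φ x))
  have hfx : (mfderiv 𝓘(ℝ, E) 𝓘(ℝ, ℝ) f x : E →L[ℝ] ℝ) =
      (fderiv ℝ F (φ x)).comp (mfderiv 𝓘(ℝ, E) 𝓘(ℝ, E) φ x : E →L[ℝ] E) := by
    have h1 : f =ᶠ[nhds x] F ∘ φ := by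
      filter_upwards [extChartAt_source_mem_nhds (I := 𝓘(ℝ, E)) x] with y hy
      exact congrArg f (φ.left_inv hy).symm
    rw [h1.mfderiv_eq, ← mfderiv_eq_fderiv]
    exact mfderiv_comp x (hFs.differentiableAt (by simp)).mdifferentiableAt
      (contMDiffAt_extChartAt (n := ∞).mdifferentiableAt (by simp))
  rw [hfx, hbr]
  have hinv : (mfderiv 𝓘(ℝ, E) 𝓘(ℝ, E) φ x).IsInvertible :=
    isInvertible_mfderiv_extChartAt (mem_extChartAt_source x)
  refine (congrArg (fderiv ℝ F (φ x)) (hinv.self_apply_inverse _)).trans h0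

end LieBracket

/-! ### Submersions: local sections and the dimension of fibres -/

section Submersion

variable {E : Type*} [NormedAddCommGroup E] [NormedSpace ℝ E]
  {N : Type*} [TopologicalSpace N] [ChartedSpace E N]
  {F : Type*} [NormedAddCommGroup F] [NormedSpace ℝ F]

open MeasureTheory Module in
/-- The image of a `C^1` map on an open subset of a second countable manifold has Hausdorff
dimension at most the dimension of the manifold. -/
lemma dimH_image_le_of_contMDiffOn [FiniteDimensional ℝ E] [SecondCountableTopology N]
    [IsManifold 𝓘(ℝ, E) 1 N] {f : N → F} {s : Set N} (hs : IsOpen s)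
    (hf : ContMDiffOn 𝓘(ℝ, E) 𝓘(ℝ, F) 1 f s) : dimH (f '' s) ≤ finrank ℝ E := by
  have hloc : ∀ x ∈ s, ∃ u ∈ nhdsWithin x s, dimH (f '' u) ≤ finrank ℝ E := fun x hx ↦ by
    have h1 : ContDiffAt ℝ 1 (f ∘ (extChartAt 𝓘(ℝ, E) x).symm) (extChartAt 𝓘(ℝ, E) x x) := by
      rw [← contMDiffAt_iff_contDiffAt]
      refine ContMDiffAt.comp_of_eq (I' := 𝓘(ℝ, E)) (hf.contMDiffAt (hs.mem_nhds hx)) ?_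
        (extChartAt_to_inv x)
      exact (contMDiffOn_extChartAt_symm x).contMDiffAt (extChartAt_target_mem_nhds x)
    obtain ⟨t, ht, hft⟩ := h1.contDiffOn le_rfl (by simp)
    -- A ball is taken because the bound for `C^1` images below is applied on a convex set.
    obtain ⟨ε, hε, hb⟩ := Metric.mem_nhds_iff.1 (by simpa using ht)
    refine ⟨(extChartAt 𝓘(ℝ, E) x).source ∩
      extChartAt 𝓘(ℝ, E) x ⁻¹' Metric.ball (extChartAt 𝓘(ℝ, E) x x) ε,
      mem_nhdsWithin_of_mem_nhds (Filter.inter_mem (extChartAt_source_mem_nhds x)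
        ((continuousAt_extChartAt x).preimage_mem_nhds (Metric.ball_mem_nhds _ hε))), ?_⟩
    calc _ ≤ dimH ((f ∘ (extChartAt 𝓘(ℝ, E) x).symm) '' Metric.ball (extChartAt 𝓘(ℝ, E) x x) ε) := by
          refine dimH_mono ?_
          rintro _ ⟨y, ⟨hy, hyb⟩, rfl⟩
          exact ⟨_, hyb, congrArg f ((extChartAt 𝓘(ℝ, E) x).left_inv hy)⟩
      _ ≤ dimH (Metric.ball (extChartAt 𝓘(ℝ, E) x x) ε) :=
          (hft.mono hb).dimH_image_le (convex_ball _ _) subset_rfl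
      _ ≤ dimH (Set.univ : Set E) := dimH_mono (Set.subset_univ _)
      _ = finrank ℝ E := Real.dimH_univ_eq_finrank E
  choose! u hu hdim using hloc
  -- Second countability leaves countably many pieces, and Hausdorff dimension is countably stable.
  obtain ⟨t, hts, htc, hcov⟩ := TopologicalSpace.countable_cover_nhdsWithin hu
  calc dimH (f '' s) ≤ dimH (⋃ x ∈ t, f '' u x) := by
        refine dimH_mono ?_
        rw [← Set.image_iUnion₂]
        exact Set.image_mono hcov
    _ = ⨆ x ∈ t, dimH (f '' u x) := dimH_bUnion htc _
    _ ≤ finrank ℝ E := iSup₂_le fun x hx ↦ hdim x (hts hx)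

variable {EB : Type*} [NormedAddCommGroup EB] [NormedSpace ℝ EB]
  {P : Type*} [TopologicalSpace P] [ChartedSpace EB P] {p : N → P} {x : N} {n : WithTop ℕ∞}

/-- A submersion has a local section through every point. -/
lemma exists_local_section_of_isSubmersionAt (h : IsSubmersionAt 𝓘(ℝ, E) 𝓘(ℝ, EB) n p x) :
    ∃ s : P → N, s (p x) = x ∧ ContMDiffAt 𝓘(ℝ, EB) 𝓘(ℝ, E) n s (p x) ∧
      ∀ᶠ y in nhds (p x), p (s y) = y := by
  set φ := h.domChart.extend 𝓘(ℝ, E) with hφ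
  set ψ := h.codChart.extend 𝓘(ℝ, EB) with hψ
  have hxφ : x ∈ φ.source := by simpa [hφ] using h.mem_domChart_source
  have hxψ : p x ∈ ψ.source := by simpa [hψ] using h.mem_codChart_source
  have hsrc : φ.source ⊆ p ⁻¹' ψ.source := by
    simpa [hφ, hψ] using h.source_subset_preimage_source
  have hw : ∀ y ∈ φ.target, ψ (p (φ.symm y)) = (h.equiv y).1 := h.writtenInCharts
  have hx1 : ψ (p x) = (h.equiv (φ x)).1 := by
    rw [← hw _ (φ.map_source hxφ), φ.left_inv hxφ]
  -- In adapted charts the submersion is a linear projection; the section freezes the complementary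
  -- coordinate at its value at `x`.
  let a : P → E := fun y ↦ h.equiv.symm (ψ y, (h.equiv (φ x)).2)
  have ha : a (p x) = φ x := by simp [a, hx1]
  have hopen : IsOpen φ.target := by
    simpa [hφ, OpenPartialHomeomorph.extend_target] using h.domChart.open_target
  have hψs : ContMDiffAt 𝓘(ℝ, EB) 𝓘(ℝ, EB) n ψ (p x) :=
    h.codChart.contMDiffAt_extend h.codChart_mem_maximalAtlas h.mem_codChart_source
  have has : ContMDiffAt 𝓘(ℝ, EB) 𝓘(ℝ, E) n a (p x) := by
    have h1 : ContDiff ℝ n fun z : EB ↦ h.equiv.symm (z, (h.equiv (φ x)).2) := by fun_prop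
    exact h1.contMDiff.contMDiffAt.comp _ hψs
  have hφs : ContMDiffOn 𝓘(ℝ, E) 𝓘(ℝ, E) n φ.symm φ.target := by
    have := contMDiffOn_extend_symm h.domChart_mem_maximalAtlas
    simpa [hφ, OpenPartialHomeomorph.extend_target] using this
  have hat : ∀ᶠ y in nhds (p x), a y ∈ φ.target :=
    has.continuousAt.preimage_mem_nhds (hopen.mem_nhds (by rw [ha]; exact φ.map_source hxφ))
  refine ⟨φ.symm ∘ a, ?_, ?_, ?_⟩
  · simp only [Function.comp_apply, ha, φ.left_inv hxφ]
  · refine ContMDiffAt.comp_of_eq (hφs.contMDiffAt (hopen.mem_nhds ?_)) has ha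
    exact φ.map_source hxφ
  · have hψo : ψ.source ∈ nhds (p x) := by
      have := h.codChart.open_source.mem_nhds h.mem_codChart_source
      simpa [hψ] using this
    filter_upwards [hat, hψo] with y hy hyψ
    have hm : p (φ.symm (a y)) ∈ ψ.source := hsrc (φ.map_target hy)
    refine ψ.injOn hm hyψ ?_
    rw [hw _ hy]
    simp [a]

/-- The derivative of a local section is a right inverse. -/
lemma surjective_mfderiv_of_isSubmersionAt (h : IsSubmersionAt 𝓘(ℝ, E) 𝓘(ℝ, EB) n p x)
    (hn : n ≠ 0) [IsManifold 𝓘(ℝ, E) n N] [IsManifold 𝓘(ℝ, EB) n P] :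
    Function.Surjective (mfderiv 𝓘(ℝ, E) 𝓘(ℝ, EB) p x : E →L[ℝ] EB) := fun w ↦ by
  obtain ⟨s, hsx, hs, hps⟩ := exists_local_section_of_isSubmersionAt h
  have hp : MDifferentiableAt 𝓘(ℝ, E) 𝓘(ℝ, EB) p (s (p x)) := by
    rw [hsx]; exact h.contMDiffAt.mdifferentiableAt hn
  have h1 := mfderiv_comp (p x) hp (hs.mdifferentiableAt hn)
  have h2 : p ∘ s =ᶠ[nhds (p x)] id := hps
  rw [h2.mfderiv_eq, mfderiv_id, hsx] at h1
  exact ⟨(mfderiv 𝓘(ℝ, EB) 𝓘(ℝ, E) s (p x) : EB →L[ℝ] E) w,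
    (congrArg (fun f : EB →L[ℝ] EB ↦ f w) h1).symm⟩

open MeasureTheory Module in
/-- If the fibre of a submersion is covered by the image of a `C^n` map from a second countable
manifold, then the dimension of this manifold is at least that of the fibre. -/
lemma finrank_le_add_of_fibre_subset_range [FiniteDimensional ℝ E] [FiniteDimensional ℝ EB]
    {EG : Type*} [NormedAddCommGroup EG] [NormedSpace ℝ EG] [FiniteDimensional ℝ EG]
    {G : Type*} [TopologicalSpace G] [SecondCountableTopology G] [ChartedSpace EG G]
    [IsManifold 𝓘(ℝ, EG) n G] [IsManifold 𝓘(ℝ, E) n N]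
    (h : IsSubmersionAt 𝓘(ℝ, E) 𝓘(ℝ, EB) n p x) (hn : 1 ≤ n) {o : G → N}
    (ho : ContMDiff 𝓘(ℝ, EG) 𝓘(ℝ, E) n o) (hfib : ∀ y, p y = p x → ∃ g, o g = y) :
    finrank ℝ E ≤ finrank ℝ EB + finrank ℝ EG := by
  set φ := h.domChart.extend 𝓘(ℝ, E) with hφ
  set ψ := h.codChart.extend 𝓘(ℝ, EB) with hψ
  have hxφ : x ∈ φ.source := by simpa [hφ] using h.mem_domChart_source
  have hxψ : p x ∈ ψ.source := by simpa [hψ] using h.mem_codChart_source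
  have hsrc : φ.source ⊆ p ⁻¹' ψ.source := by
    simpa [hφ, hψ] using h.source_subset_preimage_source
  have hw : ∀ y ∈ φ.target, ψ (p (φ.symm y)) = (h.equiv y).1 := h.writtenInCharts
  have hx1 : ψ (p x) = (h.equiv (φ x)).1 := by
    rw [← hw _ (φ.map_source hxφ), φ.left_inv hxφ]
  have hopen : IsOpen φ.target := by
    simpa [hφ, OpenPartialHomeomorph.extend_target] using h.domChart.open_target
  have hopens : IsOpen φ.source := by simpa [hφ] using h.domChart.open_source
  have hK : FiniteDimensional ℝ (EB × h.complement) :=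
    LinearEquiv.finiteDimensional h.equiv.toLinearEquiv
  have hKf : FiniteDimensional ℝ h.complement :=
    Module.Finite.of_surjective (LinearMap.snd ℝ EB h.complement) LinearMap.snd_surjective
  have hdim : finrank ℝ E = finrank ℝ EB + finrank ℝ h.complement := by
    rw [h.equiv.toLinearEquiv.finrank_eq, finrank_prod]
  -- `c` parametrizes the fibre through `x` in the chart, and `f` below reads the fibre coordinate
  -- of `o g`.
  let c : h.complement → E := fun k ↦ h.equiv.symm ((h.equiv (φ x)).1, k)
  have hc : Continuous c := by fun_prop
  have hcx : c (h.equiv (φ x)).2 = φ x := by simp [c]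
  let f : G → h.complement := fun g ↦ (h.equiv (φ (o g))).2
  have hsm : ContMDiffOn 𝓘(ℝ, EG) 𝓘(ℝ, h.complement) 1 f (o ⁻¹' φ.source) := fun g hg ↦ by
    have h1 : ContDiff ℝ 1 fun z : E ↦ (h.equiv z).2 := by fun_prop
    have h2 : ContMDiffAt 𝓘(ℝ, E) 𝓘(ℝ, E) n φ (o g) :=
      h.domChart.contMDiffAt_extend h.domChart_mem_maximalAtlas (by simpa [hφ] using hg)
    exact (h1.contMDiff.contMDiffAt.comp _
      ((h2.comp _ ho.contMDiffAt).of_le hn)).contMDiffWithinAt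
  have hG1 : IsManifold 𝓘(ℝ, EG) 1 G := IsManifold.of_le hn
  have hle := dimH_image_le_of_contMDiffOn (ho.continuous.isOpen_preimage _ hopens) hsm
  -- As `o` covers the fibre, the image of `f` contains an open set of the complement, so it has
  -- full dimension there; `hle` bounds that by `dim G`.
  have hnhds : f '' (o ⁻¹' φ.source) ∈ nhds (h.equiv (φ x)).2 := by
    have hct : c ⁻¹' φ.target ∈ nhds (h.equiv (φ x)).2 :=
      hc.continuousAt.preimage_mem_nhds (hopen.mem_nhds (by rw [hcx]; exact φ.map_source hxφ))
    filter_upwards [hct] with k hk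
    have hm : p (φ.symm (c k)) ∈ ψ.source := hsrc (φ.map_target hk)
    have hpk : p (φ.symm (c k)) = p x := by
      refine ψ.injOn hm hxψ ?_
      rw [hw _ hk, hx1]
      simp [c]
    obtain ⟨g, hg⟩ := hfib _ hpk
    refine ⟨g, ?_, ?_⟩
    · rw [Set.mem_preimage, hg]; exact φ.map_target hk
    · simp only [f, hg, φ.right_inv hk]
      simp [c]
  rw [Real.dimH_of_mem_nhds hnhds] at hle
  rw [hdim]
  exact Nat.add_le_add_left (by exact_mod_cast hle) _

end Submersion

/-! ### Free actions have immersive orbit maps -/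

section Orbit

variable {E : Type*} [NormedAddCommGroup E] [NormedSpace ℝ E]
  {Q : Type*} [TopologicalSpace Q] [ChartedSpace E Q] [IsManifold 𝓘(ℝ, E) ∞ Q]
  {EG : Type*} [NormedAddCommGroup EG] [NormedSpace ℝ EG]
  {G : Type*} [Group G] [TopologicalSpace G] [ChartedSpace EG G] [LieGroup 𝓘(ℝ, EG) ∞ G]
  [MulAction G Q]

/-- The orbit maps of a smooth free action are immersions at the identity. -/
lemma injective_mfderiv_orbitMap [CompleteSpace E] [CompleteSpace EG]
    (hsm : ContMDiff (𝓘(ℝ, EG).prod 𝓘(ℝ, E)) 𝓘(ℝ, E) ∞ (fun x : G × Q ↦ x.1 • x.2))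
    (hfree : ∀ (g : G) (q : Q), g • q = q → g = 1) (q : Q) :
    Function.Injective (mfderiv 𝓘(ℝ, EG) 𝓘(ℝ, E) (fun g : G ↦ g • q) 1 : EG →L[ℝ] E) := by
  refine (injective_iff_map_eq_zero _).2 fun ξ hξ ↦ ?_
  have h3 : (minSmoothness ℝ 3 : WithTop ℕ∞) ≤ ∞ := by
    simpa using WithTop.coe_le_coe.2 (le_top (a := (3 : ℕ∞)))
  have h1 : (1 : WithTop ℕ∞) ≤ ∞ := WithTop.coe_le_coe.2 (le_top (a := (1 : ℕ∞)))
  have h12 : (1 : WithTop ℕ∞) ≤ minSmoothness ℝ 2 := by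
    simp
  have : LieGroup 𝓘(ℝ, EG) (minSmoothness ℝ 3) G := LieGroup.of_le h3
  have : IsManifold 𝓘(ℝ, EG) 1 G := IsManifold.of_le (n := ∞) h1
  have : IsManifold 𝓘(ℝ, E) 1 Q := IsManifold.of_le (n := ∞) h1
  have ho : MDifferentiable 𝓘(ℝ, EG) 𝓘(ℝ, E) (fun g : G ↦ g • q) :=
    (hsm.comp (contMDiff_id.prodMk contMDiff_const)).mdifferentiable (by simp)
  have ha : ∀ g : G, MDifferentiable 𝓘(ℝ, E) 𝓘(ℝ, E) (fun x : Q ↦ g • x) := fun g ↦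
    (hsm.comp (contMDiff_const.prodMk contMDiff_id)).mdifferentiable (by simp)
  have hl : ∀ g : G, MDifferentiable 𝓘(ℝ, EG) 𝓘(ℝ, EG) (fun x : G ↦ g * x) := fun g ↦
    (contMDiff_mul_left (I := 𝓘(ℝ, EG)) (n := ∞)).mdifferentiable (by simp)
  -- the invariant vector field is tangent to the fibres of the orbit map
  have hzero : ∀ g : G, (mfderiv 𝓘(ℝ, EG) 𝓘(ℝ, E) (fun g : G ↦ g • q) g : EG →L[ℝ] E)
      (mulInvariantVectorField (I := 𝓘(ℝ, EG)) (G := G) ξ g : EG) = 0 := fun g ↦ by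
    have hcomm : (fun x : G ↦ x • q) ∘ (fun x : G ↦ g * x) =
        (fun x : Q ↦ g • x) ∘ (fun x : G ↦ x • q) := by
      funext x; exact mul_smul g x q
    have e1 := mfderiv_comp (1 : G) (ho (g * 1)) (hl g 1)
    have e2 := mfderiv_comp (1 : G) (ha g ((1 : G) • q)) (ho 1)
    rw [hcomm, e2, mul_one] at e1
    have e3 := congrArg (fun f : EG →L[ℝ] E ↦ f ξ) e1
    refine e3.symm.trans ?_
    exact (congrArg (mfderiv 𝓘(ℝ, E) 𝓘(ℝ, E) (fun x : Q ↦ g • x) ((1 : G) • q) : E →L[ℝ] E)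
      hξ).trans (map_zero _)
  -- Flow from `1` along the invariant field of `ξ`: `γ t • q` has zero velocity, so it stays at
  -- `q`, and freeness forces `γ t = 1`. Hence the initial velocity `ξ` is zero.
  obtain ⟨γ, hγ0, hγ⟩ := exists_isMIntegralCurveAt_of_contMDiffAt_boundaryless (t₀ := 0)
    ((contMDiffAt_mulInvariantVectorField (I := 𝓘(ℝ, EG)) (G := G) ξ (g := 1)).of_le h12)
  have haux : ∀ (A : EG →L[ℝ] E) (v : EG), A v = 0 →
      A.comp ((1 : ℝ →L[ℝ] ℝ).smulRight v) = (1 : ℝ →L[ℝ] ℝ).smulRight 0 := fun A v hv ↦ by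
    ext; simp [hv]
  have hcurve : IsMIntegralCurveAt (I := 𝓘(ℝ, E)) (fun t ↦ γ t • q) (fun _ ↦ 0) 0 := by
    filter_upwards [hγ] with t ht
    have e := (ho (γ t)).hasMFDerivAt.comp t ht
    exact e.congr_mfderiv (haux _ _ (hzero (γ t)))
  have hconst : IsMIntegralCurveAt (I := 𝓘(ℝ, E)) (fun _ ↦ q) (fun _ : Q ↦ 0) 0 :=
    (isMIntegralCurve_const rfl).isMIntegralCurveAt 0
  have heq := isMIntegralCurveAt_eventuallyEq_of_contMDiffAt_boundaryless
    (contMDiff_zeroSection ℝ (TangentSpace 𝓘(ℝ, E) : Q → Type _)).contMDiffAt hcurve hconst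
    (by simp [hγ0])
  have hγ1 : γ =ᶠ[nhds 0] fun _ ↦ 1 := by
    filter_upwards [heq] with t ht
    exact hfree _ q ht
  have hd := hγ.hasMFDerivAt.mfderiv
  rw [hγ1.mfderiv_eq, mfderiv_const] at hd
  have hd1 := congrArg (fun f : ℝ →L[ℝ] EG ↦ f 1) hd
  have hξ0 : mulInvariantVectorField (I := 𝓘(ℝ, EG)) (G := G) ξ 1 = ξ := by
    have : (fun x : G ↦ 1 * x) = id := by funext x; exact one_mul x
    rw [mulInvariantVectorField, this, mfderiv_id]
    rfl
  rw [hγ0, hξ0] at hd1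
  exact (one_smul ℝ ξ).symm.trans hd1.symm

end Orbit

/-! ### Smoothness of the cotangent lift along orbits -/

section CotangentOrbit

variable {E : Type*} [NormedAddCommGroup E] [NormedSpace ℝ E]
  {Q : Type*} [TopologicalSpace Q] [ChartedSpace E Q] [IsManifold 𝓘(ℝ, E) ∞ Q]
  {EG : Type*} [NormedAddCommGroup EG] [NormedSpace ℝ EG]
  {G : Type*} [Group G] [TopologicalSpace G] [ChartedSpace EG G] [LieGroup 𝓘(ℝ, EG) ∞ G]
  [MulAction G Q]

/-- The orbit maps of the cotangent lift of a smooth action are smooth. -/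
lemma contMDiff_cotangentLift
    (hsm : ContMDiff (𝓘(ℝ, EG).prod 𝓘(ℝ, E)) 𝓘(ℝ, E) ∞ (fun x : G × Q ↦ x.1 • x.2))
    (p : CotangentBundle E Q) :
    ContMDiff 𝓘(ℝ, EG) (cotangentModel E) ∞ (fun g : G ↦ cotangentLift g p) := by
  intro g₀
  have ho : ContMDiff 𝓘(ℝ, EG) 𝓘(ℝ, E) ∞ (fun g : G ↦ g • p.1) :=
    hsm.comp (contMDiff_id.prodMk contMDiff_const)
  refine (contMDiffAt_hom_bundle _).2 ⟨ho.contMDiffAt, ?_⟩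
  have hinv : ContMDiff (𝓘(ℝ, EG).prod 𝓘(ℝ, E)) 𝓘(ℝ, E) ∞
      (Function.uncurry fun (g : G) (x : Q) ↦ g⁻¹ • x) :=
    hsm.comp (((contMDiff_inv 𝓘(ℝ, EG) ∞).comp contMDiff_fst).prodMk contMDiff_snd)
  have h1 := ContMDiffAt.mfderiv (x₀ := g₀) (fun (g : G) (x : Q) ↦ g⁻¹ • x) (fun g : G ↦ g • p.1)
    hinv.contMDiffAt ho.contMDiffAt (m := ∞) (by simp)
  let e : Q → Trivialization E (TotalSpace.proj : TangentBundle 𝓘(ℝ, E) Q → Q) := fun b ↦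
    trivializationAt E (TangentSpace 𝓘(ℝ, E) : Q → Type _) b
  have he : ∀ b, MemTrivializationAtlas (e b) := fun b ↦ inferInstance
  -- `A` is `p` in coordinates. The lift then reads `A ∘ D(g)`, with `D(g)` the coordinate form of
  -- the derivative of `g⁻¹`, smooth by `h1`.
  let A : E →L[ℝ] ℝ := (p.2 : E →L[ℝ] ℝ).comp ((e p.1).symmL ℝ p.1 : E →L[ℝ] E)
  -- Base points are kept general because `g⁻¹ • g • p.1 = p.1` is not definitional.
  have hA : ∀ b b' : Q, b = p.1 → b' = p.1 → ∀ v : E,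
      A (((e b').continuousLinearMapAt ℝ b : E →L[ℝ] E) v) = (p.2 : E →L[ℝ] ℝ) v := by
    rintro b b' rfl rfl v
    exact congrArg (p.2 : E →L[ℝ] ℝ) ((e p.1).symmL_continuousLinearMapAt
      (FiberBundle.mem_baseSet_trivializationAt' p.1) v)
  have h2 : ContDiff ℝ ∞ fun D : E →L[ℝ] E ↦ A.comp D := by fun_prop
  refine (h2.contMDiff.contMDiffAt.comp g₀ h1).congr_of_eventuallyEq (Filter.Eventually.of_forall
    fun g ↦ ?_)
  ext w
  have h3 := hA _ _ (inv_smul_smul g p.1) (inv_smul_smul g₀ p.1)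
    ((mfderiv 𝓘(ℝ, E) 𝓘(ℝ, E) (fun x : Q ↦ g⁻¹ • x) (g • p.1) : E →L[ℝ] E)
      ((e (g₀ • p.1)).symmL ℝ (g • p.1) w : E))
  refine Eq.trans ?_ h3.symm
  have h4 := Bundle.Trivial.continuousLinearMapAt_trivialization ℝ Q ℝ (g • p.1)
  exact congrArg (fun f : ℝ →L[ℝ] ℝ ↦ f ((p.2 : E →L[ℝ] ℝ)
    ((mfderiv 𝓘(ℝ, E) 𝓘(ℝ, E) (fun x : Q ↦ g⁻¹ • x) (g • p.1) : E →L[ℝ] E)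
      ((e (g₀ • p.1)).symmL ℝ (g • p.1) w : E)))) h4

end CotangentOrbit

end Nonholonomic

namespace Nonholonomic.System

/-! ### The vertical space and the 2-form on `M` -/

section Reduction

variable {E : Type*} [NormedAddCommGroup E] [NormedSpace ℝ E]
  {Q : Type*} [TopologicalSpace Q] [ChartedSpace E Q] [IsManifold 𝓘(ℝ, E) ∞ Q]
  {EG : Type*} [NormedAddCommGroup EG] [NormedSpace ℝ EG]
  {G : Type*} [Group G] [TopologicalSpace G] [ChartedSpace EG G] [MulAction G Q]
  {sys : System E Q} {h : sys.IsSymmetry EG G}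
  {EM : Type*} [NormedAddCommGroup EM] [NormedSpace ℝ EM]
  [ChartedSpace EM sys.M] [IsManifold 𝓘(ℝ, EM) ∞ sys.M]
  {EB : Type*} [NormedAddCommGroup EB] [NormedSpace ℝ EB]
  [ChartedSpace EB h.OrbitSpace]

/-- Smoothness into an embedded submanifold can be tested in `T^*Q`. -/
lemma contMDiff_act [LieGroup 𝓘(ℝ, EG) ∞ G] (h : sys.IsSymmetry EG G)
    (hM : sys.IsEmbeddedSubmanifold EM) (m : sys.M) :
    ContMDiff 𝓘(ℝ, EG) 𝓘(ℝ, EM) ∞ (fun g : G ↦ h.act g m) := by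
  have h1 := contMDiff_cotangentLift h.smooth_action m.1
  exact (ContMDiff.iff_comp_isImmersion hM.isImmersion).2
    ⟨hM.isEmbedding.continuous_iff.2 h1.continuous, h1⟩

lemma contMDiff_τ (hM : sys.IsEmbeddedSubmanifold EM) :
    ContMDiff 𝓘(ℝ, EM) 𝓘(ℝ, E) ∞ sys.τ :=
  (contMDiff_proj _).comp hM.contMDiff

/-- Equivariance of `τ`, differentiated at the identity. It transfers both the dimension assumption
and the immersivity of orbit maps from `Q` to `M`. -/
lemma mfderiv_orbitMap_eq_comp [LieGroup 𝓘(ℝ, EG) ∞ G] (h : sys.IsSymmetry EG G)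
    (hM : sys.IsEmbeddedSubmanifold EM) (m : sys.M) :
    (mfderiv 𝓘(ℝ, EG) 𝓘(ℝ, E) (fun g : G ↦ g • sys.τ m) 1 : EG →L[ℝ] E) =
      (mfderiv 𝓘(ℝ, EM) 𝓘(ℝ, E) sys.τ m : EM →L[ℝ] E).comp
        (mfderiv 𝓘(ℝ, EG) 𝓘(ℝ, EM) (fun g : G ↦ h.act g m) 1 : EG →L[ℝ] EM) := by
  have h1 := mfderiv_comp (1 : G)
    ((contMDiff_τ hM).mdifferentiable (by simp) (h.act 1 m))
    ((contMDiff_act h hM m).mdifferentiable (by simp) 1)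
  have h2 : h.act 1 m = m := Subtype.ext (IsSymmetry.cotangentLift_one m.1)
  rw [h2] at h1
  exact h1

/-- Split `Tτ(v)` into a part in `D` and a generator of the action on `Q`; subtracting from `v` the
same generator on `M` leaves a vector of `C`. -/
lemma C_sup_verticalM [LieGroup 𝓘(ℝ, EG) ∞ G] (hM : sys.IsEmbeddedSubmanifold EM)
    (hdim : sys.DimensionAssumption h) (m : sys.M) : sys.C EM m ⊔ verticalM EM h m = ⊤ := by
  refine eq_top_iff.2 fun v _ ↦ ?_
  let τ' : EM →L[ℝ] E := mfderiv 𝓘(ℝ, EM) 𝓘(ℝ, E) sys.τ m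
  let o' : EG →L[ℝ] EM := mfderiv 𝓘(ℝ, EG) 𝓘(ℝ, EM) (fun g : G ↦ h.act g m) 1
  let d₀ : Submodule ℝ E := sys.D (sys.τ m)
  let v₀ : EM := v
  let d₁ : Submodule ℝ E := sys.verticalQ h (sys.τ m)
  have hd₁ : d₀ ⊔ d₁ = ⊤ := hdim (sys.τ m)
  have hv : τ' v₀ ∈ d₀ ⊔ d₁ := by
    rw [hd₁]; trivial
  obtain ⟨d, hd, _, ⟨ξ, rfl⟩, hs⟩ := Submodule.mem_sup.1 hv
  have h1 : τ' (o' ξ) = τ' v₀ - d := by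
    have := congrArg (fun f : EG →L[ℝ] E ↦ f ξ) (mfderiv_orbitMap_eq_comp h hM m)
    exact this.symm.trans (eq_sub_of_add_eq' hs)
  have h2 : τ' (v₀ - o' ξ) = d := by
    rw [map_sub, h1]
    exact sub_sub_cancel (τ' v₀) d
  have h3 : τ' (v₀ - o' ξ) ∈ d₀ := by
    rw [h2]; exact hd
  exact Submodule.mem_sup.2 ⟨v₀ - o' ξ, h3, o' ξ, ⟨ξ, rfl⟩, sub_add_cancel v₀ (o' ξ)⟩

lemma ρ_act (g : G) (m : sys.M) : h.ρ (h.act g m) = h.ρ m :=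
  Quotient.sound' (s₁ := h.orbitSetoid) ⟨g, rfl⟩

lemma exists_act_eq_of_ρ_eq {m m' : sys.M} (hm : h.ρ m' = h.ρ m) : ∃ g, h.act g m = m' :=
  Quotient.exact hm

/-- `ρ` is constant on orbits, so vertical vectors lie in the kernel. The vertical space has
dimension `dim G` by freeness, and the kernel at most that, since the fibre is one orbit. -/
lemma ker_mfderiv_ρ [FiniteDimensional ℝ E] [FiniteDimensional ℝ EG] [FiniteDimensional ℝ EM]
    [FiniteDimensional ℝ EB] [IsManifold 𝓘(ℝ, EB) ∞ h.OrbitSpace]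
    [LieGroup 𝓘(ℝ, EG) ∞ G] [SecondCountableTopology G]
    (hM : sys.IsEmbeddedSubmanifold EM) (hρ : IsQuotientManifold EM EB h)
    (hfree : ∀ (g : G) (q : Q), g • q = q → g = 1) (m : sys.M) :
    LinearMap.ker (mfderiv 𝓘(ℝ, EM) 𝓘(ℝ, EB) h.ρ m : EM →L[ℝ] EB).toLinearMap =
      verticalM EM h m := by
  let ρ' : EM →L[ℝ] EB := mfderiv 𝓘(ℝ, EM) 𝓘(ℝ, EB) h.ρ m
  let o' : EG →L[ℝ] EM := mfderiv 𝓘(ℝ, EG) 𝓘(ℝ, EM) (fun g : G ↦ h.act g m) 1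
  have hle : LinearMap.range o'.toLinearMap ≤ LinearMap.ker ρ'.toLinearMap := by
    rintro _ ⟨ξ, rfl⟩
    have h1 := mfderiv_comp (1 : G) (hρ.contMDiff.mdifferentiable (by simp) (h.act 1 m))
      ((contMDiff_act h hM m).mdifferentiable (by simp) 1)
    have h2 : h.act 1 m = m := Subtype.ext (IsSymmetry.cotangentLift_one m.1)
    have h3 : h.ρ ∘ (fun g : G ↦ h.act g m) = fun _ ↦ h.ρ m := funext fun g ↦ ρ_act g m
    rw [h2, h3, mfderiv_const] at h1
    exact (congrArg (fun f : EG →L[ℝ] EB ↦ f ξ) h1).symm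
  have hinj : Function.Injective o' := by
    have h1 := injective_mfderiv_orbitMap h.smooth_action hfree (sys.τ m)
    rw [mfderiv_orbitMap_eq_comp h hM m] at h1
    exact Function.Injective.of_comp h1
  have hfib := finrank_le_add_of_fibre_subset_range (hρ.isSubmersionAt m)
    (WithTop.coe_le_coe.2 (le_top (a := (1 : ℕ∞)))) (contMDiff_act h hM m)
    fun y hy ↦ exists_act_eq_of_ρ_eq hy
  have hsurj : Function.Surjective ρ' :=
    surjective_mfderiv_of_isSubmersionAt (hρ.isSubmersionAt m) (by simp)
  have h1 := LinearMap.finrank_range_of_inj (f := o'.toLinearMap) hinj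
  have h2 := LinearMap.finrank_range_add_finrank_ker ρ'.toLinearMap
  rw [LinearMap.range_eq_top.2 hsurj, finrank_top] at h2
  exact (Submodule.eq_of_le_of_finrank_le hle (by omega)).symm

lemma neg_sub_flip_swap {F : Type*} [NormedAddCommGroup F] [NormedSpace ℝ F]
    (A : F →L[ℝ] F →L[ℝ] ℝ) (x y : F) : (-(A - A.flip)) x y = -(-(A - A.flip)) y x := by
  have h1 : (-(A - A.flip)) x y = -(A x y - A y x) := rfl
  have h2 : (-(A - A.flip)) y x = -(A y x - A x y) := rfl
  rw [h1, h2]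
  ring

/-- `Ω_M` is skew because it pulls back an antisymmetrization, `B` by polarization. -/
lemma ΩB_swap (B : TwoForm EM sys.M) (m : sys.M) (u v : TangentSpace 𝓘(ℝ, EM) m) :
    ΩB B m u v = -ΩB B m v u := by
  have hΩ : sys.ΩM EM m u v = -sys.ΩM EM m v u := by
    let ι' : EM →L[ℝ] E × (E →L[ℝ] ℝ) :=
      mfderiv 𝓘(ℝ, EM) (cotangentModel E) (Subtype.val : sys.M → CotangentBundle E Q) m
    exact neg_sub_flip_swap _ (ι' u) (ι' v)
  have hB : B.toFun m u v = -B.toFun m v u := by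
    have h1 := B.alternating m (u + v)
    simp only [map_add, add_apply, B.alternating, zero_add, add_zero] at h1
    linarith
  have h1 : ΩB B m u v = sys.ΩM EM m u v + B.toFun m u v := rfl
  have h2 : ΩB B m v u = sys.ΩM EM m v u + B.toFun m v u := rfl
  rw [h1, h2, hΩ, hB]
  ring

end Reduction

end Nonholonomic.System

/-! ### Linear algebra of the reduced image -/

namespace Nonholonomic

/-- Let `C` be transverse to the kernel `V` of a surjective map `r`, and let vectors `X i` which
are, up to sign, `β`-dual on `C` to covectors `d i ∘ r` span `C ∩ V`. Then the image under `r` of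
the `β`-orthogonal of `C ∩ V` in `C` is the common kernel of the covectors `d i`. -/
lemma exists_dual_comp_iff {W WB ι : Type*} [AddCommGroup W] [Module ℝ W]
    [AddCommGroup WB] [Module ℝ WB] {C V : Submodule ℝ W} (hCV : C ⊔ V = ⊤)
    {β : W →ₗ[ℝ] W →ₗ[ℝ] ℝ} (hβ : ∀ u v, β u v = -β v u) {r : W →ₗ[ℝ] WB}
    (hr : Function.Surjective r) (hker : LinearMap.ker r = V) {X : ι → W}
    (hX : Submodule.span ℝ (Set.range X) = C ⊓ V) {d : ι → WB →ₗ[ℝ] ℝ}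
    (hd : ∀ i, ∀ Y ∈ C, β (X i) Y = -d i (r Y)) (w : WB) :
    (∃ α : WB →ₗ[ℝ] ℝ, ∃ Z ∈ C, (∀ Y ∈ C, β Z Y = α (r Y)) ∧ r Z = -w) ↔ ∀ i, d i w = 0 := by
  have hXmem : ∀ i, X i ∈ C ∧ r (X i) = 0 := fun i ↦ by
    have h1 : X i ∈ C ⊓ V := hX ▸ Submodule.subset_span ⟨i, rfl⟩
    exact ⟨h1.1, by rw [← LinearMap.mem_ker, hker]; exact h1.2⟩
  constructor
  · rintro ⟨α, Z, hZ, hα, hw⟩ i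
    have h1 := hd i Z hZ
    rw [hβ, hα _ (hXmem i).1, (hXmem i).2, hw] at h1
    simpa using h1.symm
  · intro hw
    -- Discarding the component in `V = ker r` yields a lift of `-w` lying in `C`.
    obtain ⟨v, hv⟩ := hr (-w)
    obtain ⟨c, hc, u, hu, rfl⟩ := Submodule.mem_sup.1 (hCV ▸ Submodule.mem_top : v ∈ C ⊔ V)
    have hru : r u = 0 := by rw [← LinearMap.mem_ker, hker]; exact hu
    rw [map_add, hru, add_zero] at hv
    have hle : C ⊓ V ≤ LinearMap.ker (β c) := by
      rw [← hX, Submodule.span_le]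
      rintro _ ⟨i, rfl⟩
      rw [SetLike.mem_coe, LinearMap.mem_ker, hβ, hd i c hc, hv, map_neg, hw]
      simp
    -- A functional on `C` factors through `r` exactly when it vanishes on `C ∩ ker r`, here `C ∩
    -- V`.
    have hmem : (β c).comp C.subtype ∈ LinearMap.range (r.comp C.subtype).dualMap := by
      rw [LinearMap.range_dualMap_eq_dualAnnihilator_ker, Submodule.mem_dualAnnihilator]
      intro Y hY
      exact hle ⟨Y.2, hker ▸ hY⟩
    obtain ⟨α, hα⟩ := hmem
    exact ⟨α, c, hc, fun Y hY ↦ (congrArg (fun f ↦ f ⟨Y, hY⟩) hα).symm, hv⟩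

namespace System

/-! ### The characteristic distribution as a common kernel -/

section Reduction

variable {E : Type*} [NormedAddCommGroup E] [NormedSpace ℝ E]
  {Q : Type*} [TopologicalSpace Q] [ChartedSpace E Q] [IsManifold 𝓘(ℝ, E) ∞ Q]
  {EG : Type*} [NormedAddCommGroup EG] [NormedSpace ℝ EG]
  {G : Type*} [Group G] [TopologicalSpace G] [ChartedSpace EG G] [MulAction G Q]
  {sys : System E Q} {h : sys.IsSymmetry EG G}
  {EM : Type*} [NormedAddCommGroup EM] [NormedSpace ℝ EM]
  [ChartedSpace EM sys.M] [IsManifold 𝓘(ℝ, EM) ∞ sys.M]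
  {EB : Type*} [NormedAddCommGroup EB] [NormedSpace ℝ EB]
  [ChartedSpace EB h.OrbitSpace]

/-- The function on `M/G` induced by an invariant function on `M` is smooth. -/
lemma contMDiff_comp_out (hρ : IsQuotientManifold EM EB h) {J : sys.M → ℝ}
    (hJ : ContMDiff 𝓘(ℝ, EM) 𝓘(ℝ, ℝ) ∞ J) (hJinv : ∀ (g : G) (m : sys.M), J (h.act g m) = J m) :
    ContMDiff 𝓘(ℝ, EB) 𝓘(ℝ, ℝ) ∞ (fun x : h.OrbitSpace ↦ J x.out) := by
  intro x
  obtain ⟨m, rfl⟩ := Quotient.exists_rep x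
  obtain ⟨s, hs, hsm, hsec⟩ := exists_local_section_of_isSubmersionAt (hρ.isSubmersionAt m)
  -- The choice `out` need not be continuous, but by invariance it can be replaced locally by the
  -- smooth section `s`.
  refine (hJ.contMDiffAt.comp _ hsm).congr_of_eventuallyEq ?_
  filter_upwards [hsec] with y hy
  obtain ⟨g, hg⟩ := exists_act_eq_of_ρ_eq (h := h) (hy.trans (Quotient.out_eq y).symm)
  rw [Function.comp_apply, ← hg, hJinv]

lemma out_ρ (J : sys.M → ℝ) (hJinv : ∀ (g : G) (m : sys.M), J (h.act g m) = J m) (m : sys.M) :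
    J (h.ρ m).out = J m := by
  obtain ⟨g, hg⟩ := exists_act_eq_of_ρ_eq (h := h) (Quotient.out_eq (h.ρ m))
  rw [← hg, hJinv]

/-- If the hamiltonian fields of the invariant functions `J i` span `𝒮`, then the characteristic
distribution of `π_red^B` is the common kernel of the differentials of the functions on `M/G`
induced by the `J i`. -/
lemma mem_reducedCharacteristicDistribution_iff [FiniteDimensional ℝ E] [FiniteDimensional ℝ EG]
    [FiniteDimensional ℝ EM] [FiniteDimensional ℝ EB] [IsManifold 𝓘(ℝ, EB) ∞ h.OrbitSpace]
    [LieGroup 𝓘(ℝ, EG) ∞ G] [SecondCountableTopology G]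
    (hdim : sys.DimensionAssumption h) (hfree : ∀ (g : G) (q : Q), g • q = q → g = 1)
    (hM : sys.IsEmbeddedSubmanifold EM) (hρ : IsQuotientManifold EM EB h)
    (B : TwoForm EM sys.M) (hB : Nondegenerate B) {ι : Type*} {J : ι → sys.M → ℝ}
    (hJ : ∀ i, ContMDiff 𝓘(ℝ, EM) 𝓘(ℝ, ℝ) ∞ (J i))
    (hJinv : ∀ (i : ι) (g : G) (m : sys.M), J i (h.act g m) = J i m)
    (hJS : ∀ m : sys.M,
      Submodule.span ℝ (Set.range fun i ↦ hamiltonianField B hB (J i) m) = S EM h m)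
    (x : h.OrbitSpace) (w : EB) :
    w ∈ (reducedCharacteristicDistribution EB h B hB x : Submodule ℝ EB) ↔
      ∀ i, (mfderiv 𝓘(ℝ, EB) 𝓘(ℝ, ℝ) (fun y : h.OrbitSpace ↦ J i y.out) x : EB →L[ℝ] ℝ) w = 0 := by
  -- The representative used in `reducedSharp`.
  let m : sys.M := x.out
  have hm : h.ρ m = x := Quotient.out_eq x
  let ρ' : EM →L[ℝ] EB := mfderiv 𝓘(ℝ, EM) 𝓘(ℝ, EB) h.ρ m
  let d : ι → EB →L[ℝ] ℝ := fun i ↦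
    mfderiv 𝓘(ℝ, EB) 𝓘(ℝ, ℝ) (fun y : h.OrbitSpace ↦ J i y.out) x
  have hdJ : ∀ i, (mfderiv 𝓘(ℝ, EM) 𝓘(ℝ, ℝ) (J i) m : EM →L[ℝ] ℝ) = (d i).comp ρ' := fun i ↦ by
    have h1 : J i = (fun y : h.OrbitSpace ↦ J i y.out) ∘ h.ρ :=
      funext fun m ↦ (out_ρ (J i) (hJinv i) m).symm
    have h2 := mfderiv_comp m
      ((contMDiff_comp_out hρ (hJ i) (hJinv i)).mdifferentiable (by simp) (h.ρ m))
      (hρ.contMDiff.mdifferentiable (by simp) m)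
    rw [← h1, hm] at h2
    exact h2
  let β₀ : EM →L[ℝ] EM →L[ℝ] ℝ := ΩB B m
  let β : EM →ₗ[ℝ] EM →ₗ[ℝ] ℝ := (ContinuousLinearMap.coeLM ℝ).comp β₀.toLinearMap
  have hsurj : Function.Surjective ρ' :=
    surjective_mfderiv_of_isSubmersionAt (hρ.isSubmersionAt m) (by simp)
  have key := exists_dual_comp_iff (W := EM) (WB := EB) (β := β) (r := ρ'.toLinearMap)
    (d := fun i ↦ (d i).toLinearMap) (C_sup_verticalM hM hdim m) (ΩB_swap B m) hsurj
    (ker_mfderiv_ρ hM hρ hfree m) (hJS m) (fun i Y hY ↦ ?_) w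
  · refine Iff.trans ?_ key
    constructor
    · rintro ⟨α, hα⟩
      let α₀ : EB →L[ℝ] ℝ := α
      let Z : EM := sharp B hB m (α₀.comp ρ')
      -- The sign convention `π_B^♯(α) = -X` makes `-Z` the vector representing the covector.
      have hZ := (sharp_eq_neg_iff B hB m (α₀.comp ρ') (-Z : EM)).1 (neg_neg Z).symm
      have h1 : ρ' Z = w := hα
      refine ⟨α₀.toLinearMap, -Z, hZ.1, hZ.2, ?_⟩
      show ρ' (-Z) = -w
      rw [map_neg, h1]
    · rintro ⟨α, Z, hZC, hZ, hw⟩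
      let α₀ : EB →L[ℝ] ℝ := LinearMap.toContinuousLinearMap α
      have h1 := (sharp_eq_neg_iff B hB m (α₀.comp ρ') Z).2 ⟨hZC, hZ⟩
      refine ⟨α₀, ?_⟩
      have h2 : ρ' Z = -w := hw
      refine (congrArg ρ' h1).trans ?_
      refine (map_neg ρ' Z).trans ?_
      rw [h2, neg_neg]
  · let X₀ : EM := hamiltonianField B hB (J i) m
    have h1 := (sharp_eq_neg_iff B hB m (mfderiv 𝓘(ℝ, EM) 𝓘(ℝ, ℝ) (J i) m) (-X₀ : EM)).1
      (neg_neg X₀).symm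
    have h2 : β₀ (-X₀) Y = d i (ρ' Y) :=
      (h1.2 Y hY).trans (congrArg (fun f : EM →L[ℝ] ℝ ↦ f Y) (hdJ i))
    have h3 : β₀ (-X₀) Y = -β₀ X₀ Y := by rw [map_neg]; rfl
    show β₀ X₀ Y = -d i (ρ' Y)
    rw [← h2, h3, neg_neg]

end Reduction

end System

end Nonholonomic

theorem propositionP
    {E : Type*} [NormedAddCommGroup E] [NormedSpace ℝ E] [FiniteDimensional ℝ E]
    {Q : Type*} [TopologicalSpace Q] [T2Space Q] [SecondCountableTopology Q]
    [ChartedSpace E Q] [IsManifold 𝓘(ℝ, E) ∞ Q]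
    {EG : Type*} [NormedAddCommGroup EG] [NormedSpace ℝ EG] [FiniteDimensional ℝ EG]
    {G : Type*} [Group G] [TopologicalSpace G] [T2Space G] [SecondCountableTopology G]
    [ChartedSpace EG G] [LieGroup 𝓘(ℝ, EG) ∞ G] [MulAction G Q]
    -- the nonholonomic system and its symmetry
    (sys : System E Q) (h : sys.IsSymmetry EG G)
    (hdim : sys.DimensionAssumption h)
    -- the action of `G` on `Q` is proper and free
    [ProperSMul G Q] (hfree : ∀ (g : G) (q : Q), g • q = q → g = 1)
    -- the submanifold `M` of `T^*Q`
    {EM : Type*} [NormedAddCommGroup EM] [NormedSpace ℝ EM] [FiniteDimensional ℝ EM]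
    [ChartedSpace EM sys.M] [IsManifold 𝓘(ℝ, EM) ∞ sys.M] (hM : sys.IsEmbeddedSubmanifold EM)
    -- the manifold `M/G`
    {EB : Type*} [NormedAddCommGroup EB] [NormedSpace ℝ EB] [FiniteDimensional ℝ EB]
    [ChartedSpace EB h.OrbitSpace] [IsManifold 𝓘(ℝ, EB) ∞ h.OrbitSpace]
    (hρ : System.IsQuotientManifold EM EB h)
    -- the gauge transformation by the invariant 2-form `B`
    (B : TwoForm EM sys.M) (hB : System.Nondegenerate B) (hBinv : System.InvariantTwoForm EM h B)
    -- the invariant functions `J₁, …, J_k`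
    {k : ℕ} (J : Fin k → sys.M → ℝ) (hJ : ∀ i, ContMDiff 𝓘(ℝ, EM) 𝓘(ℝ, ℝ) ∞ (J i))
    (hJinv : ∀ (i : Fin k) (g : G) (m : sys.M), J i (h.act g m) = J i m)
    (hJS : ∀ m : sys.M,
      Submodule.span ℝ (Set.range fun i ↦ System.hamiltonianField B hB (J i) m) =
        System.S EM h m) :
    IsInvolutive (System.reducedCharacteristicDistribution EB h B hB) := by
  have hchar := System.mem_reducedCharacteristicDistribution_iff hdim hfree hM hρ B hB hJ hJinv hJS
  intro U hU X Y hX hY hXD hYD x hx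
  -- Membership holds on all of the open set `U`, so the differentials of the induced functions
  -- annihilate `X` and `Y` near `x`, as the bracket lemma requires.
  have hUx := hU.mem_nhds hx
  refine (hchar x _).2 fun i ↦ mfderiv_mlieBracket_eq_zero
    (System.contMDiff_comp_out hρ (hJ i) (hJinv i))
    ((hX.contMDiffAt hUx).mdifferentiableAt (by simp))
    ((hY.contMDiffAt hUx).mdifferentiableAt (by simp)) ?_ ?_
  · filter_upwards [hUx] with y hy
    exact (hchar y _).1 (hXD y hy) i
  · filter_upwards [hUx] with y hy
    exact (hchar y _).1 (hYD y hy) i
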